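/- Let $n\in\mathbb N$, $Q=[-1,1]^n$, and let $p(q,s)=\sum_{k=0}^m p_k(q)s^k$ with $m\ge 1$, $p_k\in\mathbb R[q]=\mathbb R[q_1,\dots,q_n]$ and $p_m\equiv 1$. For $q\in Q$ let $$a(q)=\max\{\operatorname{Re}s : s\in\mathbb C,\ p(q,s)=0\}$$ be the abscissa, and let $p_\Re,p_\Im\in\mathbb R[q,x,y]$ be the real polynomials with $p(q,x+iy)=p_\Re(q,x,y)+i\,p_\Im(q,x,y)$ for all real $q,x,y$. For an integer $d\ge 1$ with $2d\ge m$, call a polynomial $v\in\mathbb R[q]$ of degree at most $2d$ feasible of order $d$ if there are sums of squares of polynomials $\sigma_0,\sigma_1,\dots,\sigma_n\in\mathbb R[q,x,y]$ with $\deg\sigma_0\le 2d$ and $\deg\sigma_j\le 2d-2$ for $1\le j\le n$, and polynomials $\tau_\Re,\tau_\Im\in\mathbb R[q,x,y]$ of degree at most $2d-m$, such that $$v(q)-x=\sigma_0+\sum_{j=1}^n\sigma_j\,(1-q_j^2)+\tau_\Re\,p_\Re+\tau_\Im\,p_\Im$$ for all $(q,x,y)\in\mathbb R^n\times\mathbb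 R^2$. Let $\rho_d\in[-\infty,+\infty]$ be the infimum of $\int_Q v(q)\,dq$ over all feasible $v$ of order $d$, and call $v$ near-optimal of order $d$ if it is feasible of order $d$ and $\int_Q v(q)\,dq\le\rho_d+\frac1d$. Then $a\in L^1(Q)$, and near-optimal solutions of order $d$ exist for all sufficiently large $d$. Moreover, let $d_0\ge 1$ with $2d_0\ge m$, and let $(v_d)_{d\ge d_0}$ be any sequence such that $v_d$ is near-optimal of order $d$ for every $d\ge d_0$. Then $v_d\in L^1(Q)$ and $v_d(q)\ge a(q)$ for all $q\in Q$ and all $d\ge d_0$, and $v_d$ converges to $a$ in $L^1(Q)$: $$\lim_{d\to\infty}\int_Q|v_d(q)-a(q)|\,dq=0 .$$ -/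

import Mathlib

open MeasureTheory Filter Topology

noncomputable section

namespace Abscissa

/-- The parameter box `[-1,1]^n`. -/
def box (n : ℕ) : Set (Fin n → ℝ) := Set.Icc (fun _ => -1) (fun _ => 1)

/-- A univariate polynomial in `s` whose coefficients are real polynomials in `q₁, …, qₙ`. -/
abbrev ParamPoly (n : ℕ) := Polynomial (MvPolynomial (Fin n) ℝ)

/-- The ring `ℝ[q, x, y]`; the variables `q` are on the left, `x` and `y` on the right. -/
abbrev QXY (n : ℕ) := MvPolynomial (Fin n ⊕ Fin 2) ℝ

/-- The variable `x` of `ℝ[q, x, y]`. -/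
def varX (n : ℕ) : QXY n := MvPolynomial.X (Sum.inr 0)

/-- The variable `y` of `ℝ[q, x, y]`. -/
def varY (n : ℕ) : QXY n := MvPolynomial.X (Sum.inr 1)

/-- A polynomial in `q`, seen in `ℝ[q, x, y]`. -/
def ofQ {n : ℕ} (v : MvPolynomial (Fin n) ℝ) : QXY n := MvPolynomial.rename Sum.inl v

/-- The complex polynomial `p(q, ·)` at a fixed parameter `q`. -/
def specialize {n : ℕ} (p : ParamPoly n) (q : Fin n → ℝ) : Polynomial ℂ :=
  p.map ((algebraMap ℝ ℂ).comp (MvPolynomial.eval q))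

/-- The abscissa of `p`: the maximal real part of the roots of `p(q, ·)`. -/
def abscissa {n : ℕ} (p : ParamPoly n) (q : Fin n → ℝ) : ℝ :=
  sSup {x : ℝ | ∃ s : ℂ, (specialize p q).IsRoot s ∧ s.re = x}

/-- For monic non-constant `p` the supremum in the definition of the abscissa is a maximum. -/
theorem abscissa_isGreatest {n : ℕ} (p : ParamPoly n) (hp : p.Monic) (hm : 0 < p.natDegree)
    (q : Fin n → ℝ) :
    IsGreatest {x : ℝ | ∃ s : ℂ, (specialize p q).IsRoot s ∧ s.re = x} (abscissa p q) := by
  have hmon : (specialize p q).Monic := hp.map _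
  have hdeg : (specialize p q).natDegree = p.natDegree := hp.natDegree_map _
  have hfin : {x : ℝ | ∃ s : ℂ, (specialize p q).IsRoot s ∧ s.re = x}.Finite := by
    have h := (Polynomial.finite_setOfPred_isRoot hmon.ne_zero).image Complex.re
    exact h
  have hne : {x : ℝ | ∃ s : ℂ, (specialize p q).IsRoot s ∧ s.re = x}.Nonempty := by
    obtain ⟨s, hs⟩ := Complex.exists_root (f := specialize p q)
      (Polynomial.natDegree_pos_iff_degree_pos.1 (by omega))
    exact ⟨s.re, s, hs, rfl⟩
  exact ⟨hne.csSup_mem hfin, fun x hx => le_csSup hfin.bddAbove hx⟩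

/-- The real and imaginary parts of `(x + i y) ^ k`, as a pair of polynomials in `ℝ[q, x, y]`. -/
def powParts (n : ℕ) : ℕ → QXY n × QXY n
  | 0 => (1, 0)
  | k + 1 => (varX n * (powParts n k).1 - varY n * (powParts n k).2,
      varY n * (powParts n k).1 + varX n * (powParts n k).2)

/-- The polynomial `p_Re` in `p(q, x + i y) = p_Re(q, x, y) + i p_Im(q, x, y)`. -/
def rePart {n : ℕ} (p : ParamPoly n) : QXY n :=
  ∑ k ∈ Finset.range (p.natDegree + 1), ofQ (p.coeff k) * (powParts n k).1

/-- The polynomial `p_Im` in `p(q, x + i y) = p_Re(q, x, y) + i p_Im(q, x, y)`. -/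
def imPart {n : ℕ} (p : ParamPoly n) : QXY n :=
  ∑ k ∈ Finset.range (p.natDegree + 1), ofQ (p.coeff k) * (powParts n k).2

/-- The value of a polynomial of `ℝ[q, x, y]` at the real point `(q, x, y)`. -/
def evalQXY {n : ℕ} (q : Fin n → ℝ) (x y : ℝ) (f : QXY n) : ℝ :=
  MvPolynomial.eval (Sum.elim q ![x, y]) f

theorem evalQXY_powParts {n : ℕ} (q : Fin n → ℝ) (x y : ℝ) (k : ℕ) :
    (evalQXY q x y (powParts n k).1 : ℂ) + evalQXY q x y (powParts n k).2 * Complex.I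
      = ((x : ℂ) + y * Complex.I) ^ k := by
  induction k with
  | zero => simp [powParts, evalQXY]
  | succ k ih =>
    rw [pow_succ, ← ih]
    simp only [powParts, evalQXY, varX, varY, map_add, map_sub, map_mul, MvPolynomial.eval_X,
      Sum.elim_inr, Matrix.cons_val_zero, Matrix.cons_val_one]
    push_cast
    linear_combination (-(y : ℂ) * (MvPolynomial.eval (Sum.elim q ![x, y]) (powParts n k).2 : ℂ))
      * Complex.I_sq

/-- The defining property of the pair `p_Re`, `p_Im`. -/
theorem specialize_eval {n : ℕ} (p : ParamPoly n) (q : Fin n → ℝ) (x y : ℝ) :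
    (specialize p q).eval ((x : ℂ) + y * Complex.I)
      = (evalQXY q x y (rePart p) : ℂ) + evalQXY q x y (imPart p) * Complex.I := by
  rw [specialize, Polynomial.eval_map, Polynomial.eval₂_eq_sum_range]
  simp only [evalQXY, rePart, imPart, ofQ, map_sum, map_mul, MvPolynomial.eval_rename,
    Sum.elim_comp_inl]
  push_cast
  rw [Finset.sum_mul, ← Finset.sum_add_distrib]
  refine Finset.sum_congr rfl fun k _ => ?_
  rw [← evalQXY_powParts q x y k]
  simp only [evalQXY, RingHom.comp_apply, Complex.coe_algebraMap]
  ring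

/-- Feasibility of `v` for the semidefinite program of order `d`: `v` has degree at most `2d` and
`v(q) - x = σ₀ + ∑ⱼ σⱼ (1 - qⱼ²) + τ_Re p_Re + τ_Im p_Im` with sums of squares `σ₀` of degree at
most `2d` and `σⱼ` of degree at most `2d - 2`, and polynomials `τ_Re`, `τ_Im` of degree at most
`2d - m`, where `m` is the degree of `p` in `s`. (It is used for `d ≥ 1` and `2d ≥ m`.) -/
def IsFeasible {n : ℕ} (p : ParamPoly n) (d : ℕ) (v : MvPolynomial (Fin n) ℝ) : Prop :=
  v.totalDegree ≤ 2 * d ∧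
  ∃ (σ₀ : QXY n) (σ : Fin n → QXY n) (τRe τIm : QXY n),
    (IsSumSq σ₀ ∧ σ₀.totalDegree ≤ 2 * d) ∧
    (∀ j, IsSumSq (σ j) ∧ (σ j).totalDegree ≤ 2 * d - 2) ∧
    τRe.totalDegree ≤ 2 * d - p.natDegree ∧
    τIm.totalDegree ≤ 2 * d - p.natDegree ∧
    ofQ v - varX n = σ₀ + ∑ j, σ j * (1 - ofQ (MvPolynomial.X j) ^ 2)
      + τRe * rePart p + τIm * imPart p

/-- The objective `∫_Q v(q) dq`, with respect to Lebesgue measure on the box. -/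
def objective {n : ℕ} (v : MvPolynomial (Fin n) ℝ) : ℝ :=
  ∫ q in box n, MvPolynomial.eval q v

/-- The optimal value `ρ_d` of the program of order `d`, an extended real
(`+∞` if there is no feasible `v`). -/
def sdpValue {n : ℕ} (p : ParamPoly n) (d : ℕ) : EReal :=
  ⨅ (v : MvPolynomial (Fin n) ℝ) (_ : IsFeasible p d v), (objective v : EReal)

/-- A near-optimal solution of order `d`: `v` is feasible and `∫_Q v ≤ ρ_d + 1/d`. -/
def IsNearOptimal {n : ℕ} (p : ParamPoly n) (d : ℕ) (v : MvPolynomial (Fin n) ℝ) : Prop :=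
  IsFeasible p d v ∧ (objective v : EReal) ≤ sdpValue p d + ((1 / (d : ℝ) : ℝ) : EReal)

end Abscissa

end

/-! Evaluating the certificate of a feasible `v` at a root of `p(q, ·)` of largest real part gives
`v ≥ a` on the box. Hence the `L¹` distance from `v` to `a` is `∫ v - ∫ a`, and it is enough to show
that the values `ρ_d` tend to `∫ a`. The abscissa is continuous, because the roots of a monic
polynomial depend continuously on its coefficients. By Stone–Weierstrass there is then a polynomial
`w > a` on the box with `∫ w < ∫ a + ε`. If `w` is feasible of all large orders, then `∫ a ≤ ∫ v_d ≤
∫ w + 1/d`, which proves the convergence.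

Feasibility of `w` is Putinar's Positivstellensatz for `w - x`, which is positive wherever the
constraints hold (`ofQ_sub_varX_mem_constraintModule`). It needs the quadratic module of the
constraints to be archimedean. No constraint bounds `x` and `y` directly, so the Cauchy-type bound
on the roots of a monic polynomial is derived inside the module (`exists_sub_normSqXY_mem`).

The Positivstellensatz itself (`mem_of_forall_pos`) comes from maximal proper quadratic modules.
They are total, and in the archimedean case each element then determines a cut of `ℝ`. The map to
cuts is an algebra homomorphism to `ℝ`, that is, a real point. -/

/-- A quadratic module of a commutative ring: a set that contains `1` and is closed under addition
and under multiplication by squares. -/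
structure IsQuadModule {A : Type*} [CommRing A] (Q : Set A) : Prop where
  one_mem : 1 ∈ Q
  add_mem : ∀ {a b : A}, a ∈ Q → b ∈ Q → a + b ∈ Q
  sq_mul_mem : ∀ (a : A) {b : A}, b ∈ Q → a * a * b ∈ Q

/-! ### Quadratic modules: closure properties and maximal extensions -/

namespace IsQuadModule

variable {A : Type*} [CommRing A] {Q : Set A}

theorem zero_mem (hQ : IsQuadModule Q) : (0 : A) ∈ Q := by
  simpa using hQ.sq_mul_mem 0 hQ.one_mem

theorem sumSq_mul_mem (hQ : IsQuadModule Q) {s b : A} (hs : IsSumSq s) (hb : b ∈ Q) :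
    s * b ∈ Q := by
  induction hs with
  | zero => simpa using hQ.zero_mem
  | sq_add a _ ih => rw [add_mul]; exact hQ.add_mem (hQ.sq_mul_mem a hb) ih

theorem sumSq_mem (hQ : IsQuadModule Q) {s : A} (hs : IsSumSq s) : s ∈ Q := by
  simpa using hQ.sumSq_mul_mem hs hQ.one_mem

theorem mul_self_mem (hQ : IsQuadModule Q) (a : A) : a * a ∈ Q :=
  hQ.sumSq_mem (.mul_self a)

/-- The quadratic module generated by a quadratic module and one more element. -/
theorem adjoin (hQ : IsQuadModule Q) (f : A) :
    IsQuadModule {x : A | ∃ q ∈ Q, ∃ s, IsSumSq s ∧ x = q + s * f} where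
  one_mem := ⟨1, hQ.one_mem, 0, .zero, by ring⟩
  add_mem := by
    rintro _ _ ⟨q, hq, s, hs, rfl⟩ ⟨q', hq', s', hs', rfl⟩
    exact ⟨q + q', hQ.add_mem hq hq', s + s', hs.add hs', by ring⟩
  sq_mul_mem := by
    rintro a _ ⟨q, hq, s, hs, rfl⟩
    exact ⟨a * a * q, hQ.sq_mul_mem a hq, a * a * s, (IsSumSq.mul_self a).mul hs, by ring⟩

/-- A proper quadratic module is contained in a maximal proper quadratic module. -/
theorem exists_maximal (hQ : IsQuadModule Q) (h1 : (-1 : A) ∉ Q) :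
    ∃ P : Set A, Q ⊆ P ∧ Maximal (fun S : Set A => IsQuadModule S ∧ (-1 : A) ∉ S) P := by
  refine zorn_subset_nonempty {S : Set A | IsQuadModule S ∧ (-1 : A) ∉ S} ?_ Q ⟨hQ, h1⟩
  intro c hc hchain ⟨S₀, hS₀⟩
  refine ⟨⋃₀ c, ⟨⟨⟨S₀, hS₀, (hc hS₀).1.one_mem⟩, ?_, ?_⟩, ?_⟩,
    fun s hs => Set.subset_sUnion_of_mem hs⟩
  · rintro a b ⟨S, hS, ha⟩ ⟨T, hT, hb⟩
    rcases hchain.total hS hT with h | h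
    · exact ⟨T, hT, (hc hT).1.add_mem (h ha) hb⟩
    · exact ⟨S, hS, (hc hS).1.add_mem ha (h hb)⟩
  · rintro a b ⟨S, hS, hb⟩
    exact ⟨S, hS, (hc hS).1.sq_mul_mem a hb⟩
  · rintro ⟨S, hS, h⟩
    exact (hc hS).2 h

section Real

variable [Algebra ℝ A]

theorem algebraMap_mul_mem (hQ : IsQuadModule Q) {c : ℝ} (hc : 0 ≤ c) {b : A} (hb : b ∈ Q) :
    algebraMap ℝ A c * b ∈ Q := by
  have h := hQ.sq_mul_mem (algebraMap ℝ A √c) hb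
  rwa [← map_mul, Real.mul_self_sqrt hc] at h

theorem algebraMap_mem (hQ : IsQuadModule Q) {c : ℝ} (hc : 0 ≤ c) : algebraMap ℝ A c ∈ Q := by
  simpa using hQ.algebraMap_mul_mem hc hQ.one_mem

theorem mem_of_algebraMap_mul_mem (hQ : IsQuadModule Q) {c : ℝ} (hc : 0 < c) {b : A}
    (hb : algebraMap ℝ A c * b ∈ Q) : b ∈ Q := by
  have h := hQ.algebraMap_mul_mem (inv_nonneg.2 hc.le) hb
  rwa [← mul_assoc, ← map_mul, inv_mul_cancel₀ hc.ne', map_one, one_mul] at h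

theorem nonneg_of_algebraMap_mem (hQ : IsQuadModule Q) (h1 : (-1 : A) ∉ Q) {c : ℝ}
    (hc : algebraMap ℝ A c ∈ Q) : 0 ≤ c := by
  by_contra! h
  refine h1 (hQ.mem_of_algebraMap_mul_mem (neg_pos.2 h) ?_)
  simpa using hc

/-- `c ^ 2 - a ^ 2 ∈ Q` as soon as `c ± a ∈ Q`. -/
theorem sq_sub_sq_mem (hQ : IsQuadModule Q) {c : ℝ} (hc : 0 < c) {a : A}
    (h₁ : algebraMap ℝ A c - a ∈ Q) (h₂ : algebraMap ℝ A c + a ∈ Q) :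
    algebraMap ℝ A (c ^ 2) - a * a ∈ Q := by
  refine hQ.mem_of_algebraMap_mul_mem (c := 2 * c) (by positivity) ?_
  -- `(c + a)² (c - a) + (c - a)² (c + a) = 2c (c² - a²)`.
  have h := hQ.add_mem (hQ.sq_mul_mem (algebraMap ℝ A c + a) h₁)
    (hQ.sq_mul_mem (algebraMap ℝ A c - a) h₂)
  convert h using 1
  simp only [map_mul, map_pow, map_ofNat]
  ring

/-- A maximal proper quadratic module is total. -/
theorem mem_or_neg_mem (hmax : Maximal (fun S : Set A => IsQuadModule S ∧ (-1 : A) ∉ S) Q)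
    (a : A) : a ∈ Q ∨ -a ∈ Q := by
  obtain ⟨hQ, h1⟩ := hmax.prop
  -- By maximality, adjoining an element outside `Q` produces `-1`.
  have key : ∀ b : A, b ∉ Q → ∃ q ∈ Q, ∃ s, IsSumSq s ∧ (-1 : A) = q + s * b := by
    intro b hb
    by_contra hcon
    refine hb (hmax.le_of_ge (y := {x : A | ∃ q ∈ Q, ∃ s, IsSumSq s ∧ x = q + s * b})
      ⟨hQ.adjoin b, hcon⟩ (fun q hq => ⟨q, hq, 0, .zero, by ring⟩) ?_)
    exact ⟨0, hQ.zero_mem, 1, .one, by ring⟩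
  by_contra! hcon
  obtain ⟨q₁, hq₁, s₁, hs₁, e₁⟩ := key a hcon.1
  obtain ⟨q₂, hq₂, s₂, hs₂, e₂⟩ := key (-a) hcon.2
  -- Adding `s₂` times the first identity to `s₁` times the second cancels `a`, leaving `-s₁ = s₂ +
  -- s₂ q₁ + s₁ q₂`.
  have hneg : -s₁ ∈ Q := by
    have h := hQ.add_mem (hQ.sumSq_mem hs₂)
      (hQ.add_mem (hQ.sumSq_mul_mem hs₂ hq₁) (hQ.sumSq_mul_mem hs₁ hq₂))
    convert h using 1
    linear_combination s₂ * e₁ + s₁ * e₂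
  -- Since `±s₁ ∈ Q`, the identity `4 b s₁ = (b + 1)² s₁ - (b - 1)² s₁` puts every multiple of `s₁`
  -- in `Q`. Then `-1 = q₁ + s₁ a` lies in `Q`.
  have hquarter : ∀ b : A, b * s₁ ∈ Q := by
    intro b
    refine hQ.mem_of_algebraMap_mul_mem (c := 4) (by norm_num) ?_
    have h := hQ.add_mem (hQ.sq_mul_mem (b + 1) (hQ.sumSq_mem hs₁)) (hQ.sq_mul_mem (b - 1) hneg)
    convert h using 1
    simp only [map_ofNat]
    ring
  apply h1
  rw [e₁, mul_comm s₁]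
  exact hQ.add_mem hq₁ (hquarter a)

/-! ### The real point defined by a maximal archimedean quadratic module -/

/-- The cut that a quadratic module defines at `a`. -/
noncomputable def cut (Q : Set A) (a : A) : ℝ := sSup {r : ℝ | a - algebraMap ℝ A r ∈ Q}

theorem bddAbove_cut
    (hmax : Maximal (fun S : Set A => IsQuadModule S ∧ (-1 : A) ∉ S) Q)
    (harch : ∀ a : A, ∃ N : ℝ, algebraMap ℝ A N - a ∈ Q)
    (a : A) : BddAbove {r : ℝ | a - algebraMap ℝ A r ∈ Q} := by
  obtain ⟨hQ, h1⟩ := hmax.prop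
  obtain ⟨N, hN⟩ := harch a
  refine ⟨N, fun r hr => ?_⟩
  have h := hQ.add_mem hN hr
  rw [sub_add_sub_cancel, ← map_sub] at h
  linarith [hQ.nonneg_of_algebraMap_mem h1 h]

theorem le_cut
    (hmax : Maximal (fun S : Set A => IsQuadModule S ∧ (-1 : A) ∉ S) Q)
    (harch : ∀ a : A, ∃ N : ℝ, algebraMap ℝ A N - a ∈ Q)
    {a : A} {r : ℝ} (h : a - algebraMap ℝ A r ∈ Q) : r ≤ cut Q a :=
  le_csSup (bddAbove_cut hmax harch a) h

theorem cut_le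
    (hmax : Maximal (fun S : Set A => IsQuadModule S ∧ (-1 : A) ∉ S) Q)
    (harch : ∀ a : A, ∃ N : ℝ, algebraMap ℝ A N - a ∈ Q)
    {a : A} {r : ℝ} (h : algebraMap ℝ A r - a ∈ Q) : cut Q a ≤ r := by
  obtain ⟨hQ, h1⟩ := hmax.prop
  refine csSup_le ?_ fun s hs => ?_
  -- The archimedean property at `-a` makes the set of lower bounds nonempty, so that its `sSup` is
  -- not a default value.
  · obtain ⟨N, hN⟩ := harch (-a)
    exact ⟨-N, by simpa [add_comm] using hN⟩
  · have h' := hQ.add_mem h hs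
    rw [sub_add_sub_cancel, ← map_sub] at h'
    linarith [hQ.nonneg_of_algebraMap_mem h1 h']

theorem mem_of_cut_lt
    (hmax : Maximal (fun S : Set A => IsQuadModule S ∧ (-1 : A) ∉ S) Q)
    (harch : ∀ a : A, ∃ N : ℝ, algebraMap ℝ A N - a ∈ Q)
    {a : A} {r : ℝ} (h : cut Q a < r) : algebraMap ℝ A r - a ∈ Q := by
  rcases mem_or_neg_mem hmax (algebraMap ℝ A r - a) with h' | h'
  · exact h'
  · rw [neg_sub] at h'
    exact absurd (le_cut hmax harch h') (not_le.2 h)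

theorem mem_of_lt_cut
    (hmax : Maximal (fun S : Set A => IsQuadModule S ∧ (-1 : A) ∉ S) Q)
    (harch : ∀ a : A, ∃ N : ℝ, algebraMap ℝ A N - a ∈ Q)
    {a : A} {r : ℝ} (h : r < cut Q a) : a - algebraMap ℝ A r ∈ Q := by
  rcases mem_or_neg_mem hmax (a - algebraMap ℝ A r) with h' | h'
  · exact h'
  · rw [neg_sub] at h'
    exact absurd (cut_le hmax harch h') (not_le.2 h)

theorem cut_add
    (hmax : Maximal (fun S : Set A => IsQuadModule S ∧ (-1 : A) ∉ S) Q)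
    (harch : ∀ a : A, ∃ N : ℝ, algebraMap ℝ A N - a ∈ Q)
    (a b : A) : cut Q (a + b) = cut Q a + cut Q b := by
  obtain ⟨hQ, h1⟩ := hmax.prop
  apply le_antisymm <;> refine le_of_forall_pos_le_add fun ε hε => ?_
  · apply cut_le hmax harch
    have h := hQ.add_mem (mem_of_cut_lt hmax harch (a := a) (r := cut Q a + ε / 2) (by linarith))
      (mem_of_cut_lt hmax harch (a := b) (r := cut Q b + ε / 2) (by linarith))
    convert h using 1
    rw [show cut Q a + cut Q b + ε = (cut Q a + ε / 2) + (cut Q b + ε / 2) by ring, map_add]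
    ring
  · rw [← sub_le_iff_le_add]
    apply le_cut hmax harch
    have h := hQ.add_mem (mem_of_lt_cut hmax harch (a := a) (r := cut Q a - ε / 2) (by linarith))
      (mem_of_lt_cut hmax harch (a := b) (r := cut Q b - ε / 2) (by linarith))
    convert h using 1
    rw [show cut Q a + cut Q b - ε = (cut Q a - ε / 2) + (cut Q b - ε / 2) by ring, map_add]
    ring

theorem cut_algebraMap
    (hmax : Maximal (fun S : Set A => IsQuadModule S ∧ (-1 : A) ∉ S) Q)
    (harch : ∀ a : A, ∃ N : ℝ, algebraMap ℝ A N - a ∈ Q)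
    (c : ℝ) : cut Q (algebraMap ℝ A c) = c := by
  obtain ⟨hQ, h1⟩ := hmax.prop
  apply le_antisymm
  · exact cut_le hmax harch (by simpa using hQ.zero_mem)
  · exact le_cut hmax harch (by simpa using hQ.zero_mem)

theorem cut_zero
    (hmax : Maximal (fun S : Set A => IsQuadModule S ∧ (-1 : A) ∉ S) Q)
    (harch : ∀ a : A, ∃ N : ℝ, algebraMap ℝ A N - a ∈ Q) : cut Q (0 : A) = 0 := by
  simpa using cut_algebraMap hmax harch 0

theorem cut_neg
    (hmax : Maximal (fun S : Set A => IsQuadModule S ∧ (-1 : A) ∉ S) Q)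
    (harch : ∀ a : A, ∃ N : ℝ, algebraMap ℝ A N - a ∈ Q)
    (a : A) : cut Q (-a) = -cut Q a := by
  have h := cut_add hmax harch a (-a)
  rw [add_neg_cancel, cut_zero hmax harch] at h
  linarith

theorem cut_nonneg
    (hmax : Maximal (fun S : Set A => IsQuadModule S ∧ (-1 : A) ∉ S) Q)
    (harch : ∀ a : A, ∃ N : ℝ, algebraMap ℝ A N - a ∈ Q)
    {a : A} (h : a ∈ Q) : 0 ≤ cut Q a :=
  le_cut hmax harch (by simpa using h)

theorem cut_le_mul_of_pos
    (hmax : Maximal (fun S : Set A => IsQuadModule S ∧ (-1 : A) ∉ S) Q)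
    (harch : ∀ a : A, ∃ N : ℝ, algebraMap ℝ A N - a ∈ Q)
    {c : ℝ} (hc : 0 < c) (a : A) :
    c * cut Q a ≤ cut Q (algebraMap ℝ A c * a) := by
  obtain ⟨hQ, h1⟩ := hmax.prop
  refine le_of_forall_pos_le_add fun ε hε => ?_
  rw [← sub_le_iff_le_add]
  apply le_cut hmax harch
  have h := hQ.algebraMap_mul_mem hc.le
    (mem_of_lt_cut hmax harch (a := a) (r := cut Q a - ε / c) (by linarith [div_pos hε hc]))
  convert h using 1
  rw [mul_sub, ← map_mul, mul_sub, mul_div_cancel₀ _ hc.ne']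

theorem cut_algebraMap_mul
    (hmax : Maximal (fun S : Set A => IsQuadModule S ∧ (-1 : A) ∉ S) Q)
    (harch : ∀ a : A, ∃ N : ℝ, algebraMap ℝ A N - a ∈ Q)
    (c : ℝ) (a : A) : cut Q (algebraMap ℝ A c * a) = c * cut Q a := by
  have pos : ∀ {c : ℝ}, 0 < c → cut Q (algebraMap ℝ A c * a) = c * cut Q a := by
    intro c hc
    refine le_antisymm ?_ (cut_le_mul_of_pos hmax harch hc a)
    have h := cut_le_mul_of_pos hmax harch hc (-a)
    rw [mul_neg, cut_neg hmax harch, cut_neg hmax harch] at h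
    linarith
  rcases lt_trichotomy c 0 with hc | rfl | hc
  · have h := pos (neg_pos.2 hc)
    rw [map_neg, neg_mul, cut_neg hmax harch] at h
    linarith
  · simp [cut_zero hmax harch]
  · exact pos hc

/-- Subtracting the constant `cut Q a` reduces to an element `b` with cut `0`. Then `√ε ± b ∈ Q` for
every `ε > 0`, hence `ε - b² ∈ Q`, so the cut of `b²` is `0` too. -/
theorem cut_mul_self
    (hmax : Maximal (fun S : Set A => IsQuadModule S ∧ (-1 : A) ∉ S) Q)
    (harch : ∀ a : A, ∃ N : ℝ, algebraMap ℝ A N - a ∈ Q)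
    (a : A) : cut Q (a * a) = cut Q a * cut Q a := by
  obtain ⟨hQ, h1⟩ := hmax.prop
  have hzero : ∀ b : A, cut Q b = 0 → cut Q (b * b) = 0 := by
    intro b hb
    refine le_antisymm (le_of_forall_pos_le_add fun ε hε => ?_)
      (cut_nonneg hmax harch (hQ.mul_self_mem b))
    rw [zero_add]
    have hs : 0 < √ε := Real.sqrt_pos.2 hε
    have h := hQ.sq_sub_sq_mem hs (mem_of_cut_lt hmax harch (a := b) (r := √ε) (by linarith))
      (by simpa [add_comm] using mem_of_lt_cut hmax harch (a := b) (r := -√ε) (by linarith))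
    rw [Real.sq_sqrt hε.le] at h
    exact cut_le hmax harch h
  have h := hzero (a + algebraMap ℝ A (-cut Q a))
    (by rw [cut_add hmax harch, cut_algebraMap hmax harch]; ring)
  rw [show (a + algebraMap ℝ A (-cut Q a)) * (a + algebraMap ℝ A (-cut Q a))
      = a * a + (algebraMap ℝ A (2 * -cut Q a) * a + algebraMap ℝ A (cut Q a * cut Q a)) by
    simp only [map_mul, map_neg, map_ofNat]; ring, cut_add hmax harch, cut_add hmax harch,
    cut_algebraMap hmax harch, cut_algebraMap_mul hmax harch] at h
  linarith

/-- Polarization of `cut_mul_self` at `a + b`. -/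
theorem cut_mul
    (hmax : Maximal (fun S : Set A => IsQuadModule S ∧ (-1 : A) ∉ S) Q)
    (harch : ∀ a : A, ∃ N : ℝ, algebraMap ℝ A N - a ∈ Q)
    (a b : A) : cut Q (a * b) = cut Q a * cut Q b := by
  have h := cut_mul_self hmax harch (a + b)
  rw [show (a + b) * (a + b) = a * a + (algebraMap ℝ A 2 * (a * b) + b * b) by
    rw [map_ofNat]; ring, cut_add hmax harch, cut_add hmax harch, cut_algebraMap_mul hmax harch,
    cut_add hmax harch, cut_mul_self hmax harch, cut_mul_self hmax harch] at h
  linarith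

/-- A maximal proper archimedean quadratic module is contained in the preimage of the nonnegative
reals under a homomorphism to `ℝ`. -/
theorem exists_algHom_of_maximal
    (hmax : Maximal (fun S : Set A => IsQuadModule S ∧ (-1 : A) ∉ S) Q)
    (harch : ∀ a : A, ∃ N : ℝ, algebraMap ℝ A N - a ∈ Q) : ∃ φ : A →ₐ[ℝ] ℝ, ∀ a ∈ Q, 0 ≤ φ a :=
  ⟨{ toFun := cut Q
     map_one' := by simpa using cut_algebraMap hmax harch 1
     map_mul' := cut_mul hmax harch
     map_zero' := cut_zero hmax harch
     map_add' := cut_add hmax harch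
     commutes' := cut_algebraMap hmax harch }, fun _ ha => cut_nonneg hmax harch ha⟩

/-! ### The abstract Positivstellensatz -/

/-- If `s f - 1 ∈ Q` for a sum of squares `s` and `Q` is archimedean, then `f ∈ Q`. -/
theorem mem_of_sumSq_mul_sub_one_mem (hQ : IsQuadModule Q)
    (harch : ∀ a : A, ∃ N : ℝ, algebraMap ℝ A N - a ∈ Q) {f s : A} (hs : IsSumSq s)
    (h : s * f - 1 ∈ Q) : f ∈ Q := by
  obtain ⟨N, hN1, hNs, hNf⟩ : ∃ N : ℝ, 1 ≤ N ∧ algebraMap ℝ A N - s ∈ Q ∧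
      algebraMap ℝ A (2 * N) - (s * s * f + 1) ∈ Q := by
    obtain ⟨N₁, h₁⟩ := harch s
    obtain ⟨N₂, h₂⟩ := harch (s * s * f + 1)
    refine ⟨max 1 (max N₁ N₂), le_max_left _ _, ?_, ?_⟩
    · have h := hQ.add_mem h₁ (hQ.algebraMap_mem (c := max 1 (max N₁ N₂) - N₁) (by simp))
      convert h using 1
      rw [map_sub]; ring
    · have h := hQ.add_mem h₂ (hQ.algebraMap_mem (c := 2 * max 1 (max N₁ N₂) - N₂)
        (by linarith [le_max_left 1 (max N₁ N₂), le_max_right 1 (max N₁ N₂), le_max_right N₁ N₂]))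
      convert h using 1
      rw [map_sub]; ring
  have hN0 : 0 < N := by linarith
  set c := algebraMap ℝ A N with hc
  have hsN : s * (2 * c - s) ∈ Q := by
    have h₁ : s * (c - s) ∈ Q := by
      refine hQ.mem_of_algebraMap_mul_mem hN0 ?_
      have h := hQ.add_mem (hQ.sq_mul_mem s hNs) (hQ.sq_mul_mem (c - s) (hQ.sumSq_mem hs))
      convert h using 1
      ring
    have h := hQ.add_mem h₁ (hQ.algebraMap_mul_mem hN0.le (hQ.sumSq_mem hs))
    convert h using 1
    ring
  -- Each application lowers `k` by the fixed amount `1/N²`, by the identity `N² (f + k) - 1 = (N -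
  -- s)² (f + k) + 2N (s f - 1) + (2N - (s² f + 1)) + k s (2N - s)`.
  have step : ∀ k : ℝ, 0 ≤ k → f + algebraMap ℝ A k ∈ Q →
      f + algebraMap ℝ A (k - 1 / N ^ 2) ∈ Q := by
    intro k hk hfk
    refine hQ.mem_of_algebraMap_mul_mem (c := N ^ 2) (by positivity) ?_
    have h := hQ.add_mem (hQ.sq_mul_mem (c - s) hfk)
      (hQ.add_mem (hQ.algebraMap_mul_mem (c := 2 * N) (by positivity) h)
        (hQ.add_mem hNf (hQ.algebraMap_mul_mem hk hsN)))
    convert h using 1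
    rw [mul_add, ← map_mul, mul_sub, mul_one_div_cancel (by positivity)]
    simp only [map_mul, map_sub, map_pow, map_ofNat, map_one, ← hc]
    ring
  obtain ⟨K, hK⟩ := harch (-f)
  have hdesc : ∀ j : ℕ, ∃ k : ℝ, k ≤ max (K - j / N ^ 2) 0 ∧ f + algebraMap ℝ A k ∈ Q := by
    intro j
    induction j with
    | zero => exact ⟨K, by simp, by simpa [add_comm] using hK⟩
    | succ j ih =>
      obtain ⟨k, hk, hfk⟩ := ih
      rcases le_or_gt k 0 with h0 | h0
      · exact ⟨k, h0.trans (le_max_right _ _), hfk⟩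
      · refine ⟨_, ?_, step k h0.le hfk⟩
        rcases le_max_iff.1 hk with h | h
        · refine le_max_of_le_left ?_
          push_cast
          rw [add_div]
          linarith
        · linarith
  obtain ⟨j, hj⟩ := exists_nat_ge (K * N ^ 2)
  obtain ⟨k, hk, hfk⟩ := hdesc j
  have hk0 : k ≤ 0 := by
    refine hk.trans (max_le ?_ le_rfl)
    rw [sub_nonpos, le_div_iff₀ (by positivity)]
    exact hj
  have h := hQ.add_mem hfk (hQ.algebraMap_mem (neg_nonneg.2 hk0))
  simpa [add_assoc] using h

/-- **Putinar's Positivstellensatz**, abstract form: an element that is positive at all real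
points at which an archimedean quadratic module is nonnegative belongs to it. -/
theorem mem_of_forall_pos (hQ : IsQuadModule Q)
    (harch : ∀ a : A, ∃ N : ℝ, algebraMap ℝ A N - a ∈ Q) {f : A}
    (hf : ∀ φ : A →ₐ[ℝ] ℝ, (∀ a ∈ Q, 0 ≤ φ a) → 0 < φ f) : f ∈ Q := by
  -- If adjoining `-f` gives `-1 = q - s f`, then `s f - 1 = q ∈ Q`. Otherwise a maximal extension
  -- gives a real point nonnegative on `Q` with `φ f ≤ 0`.
  by_cases h1 : (-1 : A) ∈ {x : A | ∃ q ∈ Q, ∃ s, IsSumSq s ∧ x = q + s * -f}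
  · obtain ⟨q, hq, s, hs, e⟩ := h1
    refine hQ.mem_of_sumSq_mul_sub_one_mem harch hs ?_
    convert hq using 1
    linear_combination e
  · obtain ⟨P, hP, hmax⟩ := (hQ.adjoin (-f)).exists_maximal h1
    have hQP : Q ⊆ P := fun q hq => hP ⟨q, hq, 0, .zero, by ring⟩
    obtain ⟨φ, hφ⟩ := exists_algHom_of_maximal hmax fun a => (harch a).imp fun _ h => hQP h
    have h₁ := hf φ fun a ha => hφ a (hQP ha)
    have h₂ := hφ (-f) (hP ⟨0, hQ.zero_mem, 1, .one, by ring⟩)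
    rw [map_neg] at h₂
    linarith

/-! ### The ring of bounded elements -/

/-- `a` is bounded with respect to `Q`. -/
def IsBdd (Q : Set A) (a : A) : Prop :=
  ∃ N : ℝ, 0 < N ∧ algebraMap ℝ A N - a ∈ Q ∧ algebraMap ℝ A N + a ∈ Q

theorem isBdd_algebraMap (hQ : IsQuadModule Q) (c : ℝ) : IsBdd Q (algebraMap ℝ A c) := by
  refine ⟨|c| + 1, by positivity, ?_, ?_⟩
  · rw [← map_sub]; exact hQ.algebraMap_mem (by linarith [le_abs_self c])
  · rw [← map_add]; exact hQ.algebraMap_mem (by linarith [neg_abs_le c])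

theorem IsBdd.neg {a : A} (ha : IsBdd Q a) : IsBdd Q (-a) := by
  obtain ⟨N, h0, h₁, h₂⟩ := ha
  exact ⟨N, h0, by simpa using h₂, by simpa [sub_eq_add_neg] using h₁⟩

theorem IsBdd.add (hQ : IsQuadModule Q) {a b : A} (ha : IsBdd Q a) (hb : IsBdd Q b) :
    IsBdd Q (a + b) := by
  obtain ⟨N, h0, h₁, h₂⟩ := ha
  obtain ⟨N', h0', h₁', h₂'⟩ := hb
  refine ⟨N + N', by positivity, ?_, ?_⟩
  · convert hQ.add_mem h₁ h₁' using 1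
    rw [map_add]; ring
  · convert hQ.add_mem h₂ h₂' using 1
    rw [map_add]; ring

theorem IsBdd.mul_self (hQ : IsQuadModule Q) {a : A} (ha : IsBdd Q a) : IsBdd Q (a * a) := by
  obtain ⟨N, h0, h₁, h₂⟩ := ha
  exact ⟨N ^ 2, by positivity, hQ.sq_sub_sq_mem h0 h₁ h₂,
    hQ.add_mem (hQ.algebraMap_mem (by positivity)) (hQ.mul_self_mem a)⟩

theorem IsBdd.algebraMap_mul (hQ : IsQuadModule Q) {c : ℝ} (hc : 0 < c) {a : A}
    (ha : IsBdd Q a) : IsBdd Q (algebraMap ℝ A c * a) := by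
  obtain ⟨N, h0, h₁, h₂⟩ := ha
  refine ⟨c * N, by positivity, ?_, ?_⟩
  · rw [map_mul, ← mul_sub]; exact hQ.algebraMap_mul_mem hc.le h₁
  · rw [map_mul, ← mul_add]; exact hQ.algebraMap_mul_mem hc.le h₂

theorem IsBdd.mul (hQ : IsQuadModule Q) {a b : A} (ha : IsBdd Q a) (hb : IsBdd Q b) :
    IsBdd Q (a * b) := by
  -- Polarization: `a b = ((a + b)² - (a - b)²) / 4`.
  have h := (((ha.add hQ hb).mul_self hQ).add hQ
    ((ha.add hQ hb.neg).mul_self hQ).neg).algebraMap_mul hQ (c := 1 / 4) (by norm_num)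
  convert h using 1
  have h4 : algebraMap ℝ A (1 / 4) * 4 = 1 := by
    rw [← map_ofNat (algebraMap ℝ A) 4, ← map_mul]; norm_num
  linear_combination -(a * b) * h4

theorem isBdd_of_sub_sq_mem (hQ : IsQuadModule Q) {N : ℝ} {a : A}
    (h : algebraMap ℝ A N - a * a ∈ Q) : IsBdd Q a := by
  have key : ∀ b : A, b * b = a * a → algebraMap ℝ A (|N| + 1) - b ∈ Q := by
    intro b hb
    refine hQ.mem_of_algebraMap_mul_mem (c := 2) (by norm_num) ?_
    -- `(N - b²) + (1 - b)² = N + 1 - 2b`; the last summand raises the constant to `2(|N| + 1)`.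
    have h := hQ.add_mem (hQ.add_mem h (hQ.mul_self_mem (1 - b)))
      (hQ.algebraMap_mem (c := (|N| - N) + |N| + 1)
        (by linarith [le_abs_self N, abs_nonneg N]))
    convert h using 1
    simp only [map_add, map_sub, map_ofNat, map_one]
    linear_combination -hb
  exact ⟨|N| + 1, by positivity, key a rfl, by simpa using key (-a) (by ring)⟩

end Real

end IsQuadModule

/-- A quadratic module of a polynomial ring is archimedean if the variables are bounded. -/
theorem IsQuadModule.isBdd_of_forall_X {σ : Type*} {Q : Set (MvPolynomial σ ℝ)}
    (hQ : IsQuadModule Q) (h : ∀ i, IsBdd Q (MvPolynomial.X i : MvPolynomial σ ℝ))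
    (f : MvPolynomial σ ℝ) : IsBdd Q f := by
  induction f using MvPolynomial.induction_on with
  | C c => exact hQ.isBdd_algebraMap c
  | add f g hf hg => exact hf.add hQ hg
  | mul_X f i hf => exact hf.mul hQ (h i)


/-! ### Polynomial inequalities for a sum of squares -/

theorem IsSumSq.pow {A : Type*} [CommRing A] {s : A} (hs : IsSumSq s) (k : ℕ) :
    IsSumSq (s ^ k) := by
  induction k with
  | zero => simp
  | succ k ih => rw [pow_succ]; exact ih.mul hs

namespace IsQuadModule

variable {A : Type*} [CommRing A] [Algebra ℝ A] {Q : Set A}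

/-- A monic univariate polynomial in a sum of squares is bounded below. -/
theorem exists_pow_sub_sum_add_mem (hQ : IsQuadModule Q) {r : A} (hr : IsSumSq r) (m : ℕ)
    (c : ℕ → ℝ) : ∃ N : ℝ,
      r ^ m - ∑ k ∈ Finset.range m, algebraMap ℝ A (c k) * r ^ k + algebraMap ℝ A N ∈ Q := by
  induction m using Nat.strong_induction_on generalizing c with
  | _ m ih =>
  match m with
  | 0 => exact ⟨0, by simpa using hQ.one_mem⟩
  | 1 => exact ⟨c 0, by simpa using hQ.sumSq_mem hr⟩
  | m + 2 =>
    -- Subtracting `(r - b)² r^m` leaves `r^(m+1)` with coefficient `2b - c (m + 1)`. This `b` makes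
    -- it `1`, so the remainder is monic of degree `m + 1`.
    set b : ℝ := (1 + c (m + 1)) / 2 with hb
    obtain ⟨N, hN⟩ := ih (m + 1) (by omega) (fun k => if k = m then b ^ 2 + c m else c k)
    refine ⟨N, ?_⟩
    have h := hQ.add_mem hN
      (hQ.sumSq_mem ((IsSumSq.mul_self (r - algebraMap ℝ A b)).mul (hr.pow m)))
    convert h using 1
    have hsum : ∑ k ∈ Finset.range m,
        algebraMap ℝ A (if k = m then b ^ 2 + c m else c k) * r ^ k
        = ∑ k ∈ Finset.range m, algebraMap ℝ A (c k) * r ^ k :=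
      Finset.sum_congr rfl fun k hk => by rw [if_neg (Finset.mem_range.1 hk).ne]
    rw [Finset.sum_range_succ, Finset.sum_range_succ, Finset.sum_range_succ, hsum, if_pos rfl,
      show c (m + 1) = 2 * b - 1 by rw [hb]; ring]
    simp only [map_add, map_sub, map_mul, map_pow, map_ofNat, map_one]
    ring

/-- A sum of squares `r` with `r ^ m ≤ ∑ k < m, c k * r ^ k` modulo `Q` is bounded above. -/
theorem exists_algebraMap_sub_mem_of_pow (hQ : IsQuadModule Q) {r : A} (hr : IsSumSq r) {m : ℕ}
    (hm : 0 < m) (c : ℕ → ℝ)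
    (h : ∑ k ∈ Finset.range m, algebraMap ℝ A (c k) * r ^ k - r ^ m ∈ Q) :
    ∃ N : ℝ, algebraMap ℝ A N - r ∈ Q := by
  obtain ⟨m, rfl⟩ := Nat.exists_eq_succ_of_ne_zero hm.ne'
  -- These are the coefficients of `r ∑ c k r^k + r`. Adding `r` times the hypothesis therefore
  -- cancels everything except `N - r`.
  obtain ⟨N, hN⟩ := hQ.exists_pow_sub_sum_add_mem hr (m + 2)
    (fun k => if k = 0 then 0 else if k = 1 then c 0 + 1 else c (k - 1))
  refine ⟨N, ?_⟩
  have h' := hQ.add_mem hN (hQ.sumSq_mul_mem hr h)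
  convert h' using 1
  rw [Finset.sum_range_succ', Finset.sum_range_succ', Nat.succ_eq_add_one, Finset.sum_range_succ',
    mul_sub, mul_add, Finset.mul_sum]
  have hsum : ∑ k ∈ Finset.range m, r * (algebraMap ℝ A (c (k + 1)) * r ^ (k + 1))
      = ∑ k ∈ Finset.range m, algebraMap ℝ A (c (k + 1)) * r ^ (k + 1 + 1) :=
    Finset.sum_congr rfl fun k _ => by ring
  simp [hsum]
  ring

end IsQuadModule

/-! ### The constraint module is archimedean -/

namespace Abscissa

variable {n : ℕ}

/-- The quadratic module generated by the constraints of the program, without degree bounds. -/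
def constraintModule (p : ParamPoly n) : Set (QXY n) :=
  {f | ∃ (σ₀ : QXY n) (σ : Fin n → QXY n) (τRe τIm : QXY n),
    IsSumSq σ₀ ∧ (∀ j, IsSumSq (σ j)) ∧
    f = σ₀ + ∑ j, σ j * (1 - ofQ (MvPolynomial.X j) ^ 2) + τRe * rePart p + τIm * imPart p}

theorem isQuadModule_constraintModule (p : ParamPoly n) : IsQuadModule (constraintModule p) where
  one_mem := ⟨1, 0, 0, 0, .one, fun _ => .zero, by simp⟩
  add_mem := by
    rintro _ _ ⟨σ₀, σ, τ, τ', h₀, h, rfl⟩ ⟨ρ₀, ρ, υ, υ', h₀', h', rfl⟩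
    refine ⟨σ₀ + ρ₀, σ + ρ, τ + υ, τ' + υ', h₀.add h₀', fun j => (h j).add (h' j), ?_⟩
    simp only [Pi.add_apply, add_mul, Finset.sum_add_distrib]
    ring
  sq_mul_mem := by
    rintro a _ ⟨σ₀, σ, τ, τ', h₀, h, rfl⟩
    refine ⟨a * a * σ₀, fun j => a * a * σ j, a * a * τ, a * a * τ', (IsSumSq.mul_self a).mul h₀,
      fun j => (IsSumSq.mul_self a).mul (h j), ?_⟩
    simp only [mul_add, Finset.mul_sum, mul_assoc]

theorem one_sub_sq_mem_constraintModule (p : ParamPoly n) (j : Fin n) :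
    1 - ofQ (MvPolynomial.X j) ^ 2 ∈ constraintModule p := by
  refine ⟨0, Pi.single j 1, 0, 0, .zero, fun i => ?_, ?_⟩
  · rcases eq_or_ne i j with rfl | hij
    · simp
    · simp [Pi.single_eq_of_ne hij]
  · rw [Finset.sum_eq_single j (fun i _ hij => by simp [Pi.single_eq_of_ne hij]) (by simp)]
    simp

theorem mul_rePart_mem_constraintModule (p : ParamPoly n) (f : QXY n) :
    f * rePart p ∈ constraintModule p :=
  ⟨0, 0, f, 0, .zero, fun _ => .zero, by simp⟩

theorem mul_imPart_mem_constraintModule (p : ParamPoly n) (f : QXY n) :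
    f * imPart p ∈ constraintModule p :=
  ⟨0, 0, 0, f, .zero, fun _ => .zero, by simp⟩

/-- The bounded elements are closed under sums and products, and `1 - qⱼ²` bounds each `qⱼ`. -/
theorem isBdd_ofQ (p : ParamPoly n) (f : MvPolynomial (Fin n) ℝ) :
    IsQuadModule.IsBdd (constraintModule p) (ofQ f) := by
  have hQ := isQuadModule_constraintModule p
  induction f using MvPolynomial.induction_on with
  | C c => simpa [ofQ] using hQ.isBdd_algebraMap c
  | add f g hf hg => simpa [ofQ] using hf.add hQ hg
  | mul_X f j hf =>
    have h : IsQuadModule.IsBdd (constraintModule p) (ofQ (MvPolynomial.X j)) :=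
      hQ.isBdd_of_sub_sq_mem (N := 1) (by
        simpa [sq] using one_sub_sq_mem_constraintModule p j)
    simpa [ofQ] using hf.mul hQ h

/-- The squared modulus of `s = x + i y`. -/
noncomputable def normSqXY (n : ℕ) : QXY n := varX n * varX n + varY n * varY n

theorem isSumSq_normSqXY (n : ℕ) : IsSumSq (normSqXY n) :=
  (IsSumSq.mul_self _).add (.mul_self _)

/-- The polynomial form of `|s^k|² = |s|^(2k)`. -/
theorem powParts_sq_add_sq (n k : ℕ) :
    (powParts n k).1 * (powParts n k).1 + (powParts n k).2 * (powParts n k).2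
      = normSqXY n ^ k := by
  induction k with
  | zero => simp [powParts]
  | succ k ih =>
    rw [pow_succ, ← ih]
    simp only [powParts, normSqXY]
    ring

/-- Bounds `|∑ k < j, p_k s^k|²` by a real polynomial in `|s|²` of degree less than `j`. The
induction uses `|u + t|² ≤ 2|u|² + 2|t|²`, whose defect is the square `|u - t|²`, and the
boundedness of the coefficients. -/
theorem exists_sum_sub_partialSum_sq_mem (p : ParamPoly n) (j : ℕ) : ∃ c : ℕ → ℝ,
    ∑ k ∈ Finset.range j, algebraMap ℝ (QXY n) (c k) * normSqXY n ^ k -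
      ((∑ k ∈ Finset.range j, ofQ (p.coeff k) * (powParts n k).1) ^ 2 +
        (∑ k ∈ Finset.range j, ofQ (p.coeff k) * (powParts n k).2) ^ 2) ∈ constraintModule p := by
  have hQ := isQuadModule_constraintModule p
  induction j with
  | zero => exact ⟨0, by simpa using hQ.zero_mem⟩
  | succ j ih =>
    obtain ⟨c, hc⟩ := ih
    obtain ⟨N, -, hN, -⟩ := (isBdd_ofQ p (p.coeff j)).mul_self hQ
    refine ⟨fun k => if k = j then 2 * N else 2 * c k, ?_⟩
    set U := ∑ k ∈ Finset.range j, ofQ (p.coeff k) * (powParts n k).1 with hU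
    set V := ∑ k ∈ Finset.range j, ofQ (p.coeff k) * (powParts n k).2 with hV
    have hsum : ∑ k ∈ Finset.range j,
        algebraMap ℝ (QXY n) (if k = j then 2 * N else 2 * c k) * normSqXY n ^ k
        = 2 * ∑ k ∈ Finset.range j, algebraMap ℝ (QXY n) (c k) * normSqXY n ^ k := by
      rw [Finset.mul_sum]
      refine Finset.sum_congr rfl fun k hk => ?_
      rw [if_neg (Finset.mem_range.1 hk).ne, map_mul, map_ofNat, mul_assoc]
    have h := hQ.add_mem (hQ.add_mem hc hc) (hQ.add_mem
      (hQ.add_mem (hQ.sumSq_mul_mem ((isSumSq_normSqXY n).pow j) hN)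
        (hQ.sumSq_mul_mem ((isSumSq_normSqXY n).pow j) hN))
      (hQ.add_mem (hQ.mul_self_mem (U - ofQ (p.coeff j) * (powParts n j).1))
        (hQ.mul_self_mem (V - ofQ (p.coeff j) * (powParts n j).2))))
    convert h using 1
    rw [Finset.sum_range_succ, Finset.sum_range_succ, Finset.sum_range_succ, hsum, ← hU,
      ← hV]
    simp only [if_true, map_mul, map_ofNat]
    linear_combination (2 * ofQ (p.coeff j) ^ 2) * -powParts_sq_add_sq n j

/-- At a root, `s^m` is minus the sum of the lower terms. So `|s|^(2m)` is at most a polynomial in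
`|s|²` of degree less than `m`, which bounds `|s|²`. -/
theorem exists_sub_normSqXY_mem (p : ParamPoly n) (hp : p.Monic) (hm : 0 < p.natDegree) :
    ∃ N : ℝ, algebraMap ℝ (QXY n) N - normSqXY n ∈ constraintModule p := by
  have hQ := isQuadModule_constraintModule p
  obtain ⟨c, hc⟩ := exists_sum_sub_partialSum_sq_mem p p.natDegree
  refine hQ.exists_algebraMap_sub_mem_of_pow (isSumSq_normSqXY n) hm c ?_
  set U := ∑ k ∈ Finset.range p.natDegree, ofQ (p.coeff k) * (powParts n k).1 with hU
  set V := ∑ k ∈ Finset.range p.natDegree, ofQ (p.coeff k) * (powParts n k).2 with hV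
  have hre : rePart p = U + (powParts n p.natDegree).1 := by
    rw [rePart, Finset.sum_range_succ, ← hU, hp.coeff_natDegree]; simp [ofQ]
  have him : imPart p = V + (powParts n p.natDegree).2 := by
    rw [imPart, Finset.sum_range_succ, ← hV, hp.coeff_natDegree]; simp [ofQ]
  -- With `P = Re s^m`, `p_Re = U + P` and `(U - P)(U + P) = U² - P²`, so the multiplier `U - P`
  -- replaces `U²` by `P²`; likewise for the imaginary part.
  have h := hQ.add_mem hc (hQ.add_mem
    (mul_rePart_mem_constraintModule p (U - (powParts n p.natDegree).1))
    (mul_imPart_mem_constraintModule p (V - (powParts n p.natDegree).2)))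
  convert h using 1
  rw [hre, him]
  linear_combination powParts_sq_add_sq n p.natDegree

theorem isBdd_constraintModule (p : ParamPoly n) (hp : p.Monic) (hm : 0 < p.natDegree)
    (f : QXY n) : IsQuadModule.IsBdd (constraintModule p) f := by
  have hQ := isQuadModule_constraintModule p
  obtain ⟨N, hN⟩ := exists_sub_normSqXY_mem p hp hm
  have hx : IsQuadModule.IsBdd (constraintModule p) (varX n) :=
    hQ.isBdd_of_sub_sq_mem (N := N) (by
      convert hQ.add_mem hN (hQ.mul_self_mem (varY n)) using 1
      rw [normSqXY]; ring)
  have hy : IsQuadModule.IsBdd (constraintModule p) (varY n) :=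
    hQ.isBdd_of_sub_sq_mem (N := N) (by
      convert hQ.add_mem hN (hQ.mul_self_mem (varX n)) using 1
      rw [normSqXY]; ring)
  refine hQ.isBdd_of_forall_X (fun i => ?_) f
  rcases i with j | i
  · simpa [ofQ] using isBdd_ofQ p (MvPolynomial.X j)
  · fin_cases i
    · exact hx
    · exact hy

/-! ### Certificates and feasibility -/

theorem isRoot_iff (p : ParamPoly n) (q : Fin n → ℝ) (x y : ℝ) :
    (specialize p q).IsRoot ((x : ℂ) + y * Complex.I) ↔
      evalQXY q x y (rePart p) = 0 ∧ evalQXY q x y (imPart p) = 0 := by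
  rw [Polynomial.IsRoot.def, specialize_eval, Complex.ext_iff]
  simp

theorem evalQXY_ofQ (q : Fin n → ℝ) (x y : ℝ) (v : MvPolynomial (Fin n) ℝ) :
    evalQXY q x y (ofQ v) = MvPolynomial.eval q v := by
  simp [evalQXY, ofQ, MvPolynomial.eval_rename, Sum.elim_comp_inl]

theorem mem_box_iff {q : Fin n → ℝ} : q ∈ box n ↔ ∀ j, q j ^ 2 ≤ 1 := by
  simp only [box, Set.mem_Icc, Pi.le_def, ← forall_and, sq_le_one_iff_abs_le_one, abs_le]

/-- A polynomial that is larger than the abscissa on the box has a certificate. -/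
theorem ofQ_sub_varX_mem_constraintModule (p : ParamPoly n) (hp : p.Monic) (hm : 0 < p.natDegree)
    {w : MvPolynomial (Fin n) ℝ} (hw : ∀ q ∈ box n, abscissa p q < MvPolynomial.eval q w) :
    ofQ w - varX n ∈ constraintModule p := by
  refine (isQuadModule_constraintModule p).mem_of_forall_pos (fun a => ?_) fun φ hφ => ?_
  · obtain ⟨N, -, h, -⟩ := isBdd_constraintModule p hp hm a
    exact ⟨N, h⟩
  set q : Fin n → ℝ := fun j => φ (MvPolynomial.X (Sum.inl j)) with hq
  set x : ℝ := φ (varX n) with hx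
  set y : ℝ := φ (varY n) with hy
  -- A homomorphism from a polynomial ring to `ℝ` is evaluation at the images of the variables.
  have heval : ∀ f, φ f = evalQXY q x y f := by
    intro f
    have hfun : (fun i => φ (MvPolynomial.X i)) = Sum.elim q ![x, y] := by
      funext i
      rcases i with j | i
      · rfl
      · fin_cases i <;> rfl
    have h : φ f = MvPolynomial.aeval (fun i => φ (MvPolynomial.X i)) f :=
      DFunLike.congr_fun (MvPolynomial.aeval_unique φ) f
    rw [h, hfun]
    rfl
  have hbox : q ∈ box n := by
    refine mem_box_iff.2 fun j => ?_
    have h := hφ _ (one_sub_sq_mem_constraintModule p j)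
    rw [map_sub, map_one, map_pow, heval, evalQXY_ofQ, MvPolynomial.eval_X] at h
    linarith
  have hzero : ∀ g : QXY n, (∀ f, f * g ∈ constraintModule p) → evalQXY q x y g = 0 := by
    intro g hg
    rw [← heval]
    have h₁ := hφ _ (hg 1)
    have h₂ := hφ _ (hg (-1))
    rw [map_mul, map_one] at h₁
    rw [map_mul, map_neg, map_one] at h₂
    linarith
  have hroot : (specialize p q).IsRoot ((x : ℂ) + y * Complex.I) :=
    (isRoot_iff p q x y).2 ⟨hzero _ (mul_rePart_mem_constraintModule p),
      hzero _ (mul_imPart_mem_constraintModule p)⟩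
  have hle : x ≤ abscissa p q := (abscissa_isGreatest p hp hm q).2 ⟨_, hroot, by simp⟩
  rw [map_sub, heval (ofQ w), evalQXY_ofQ, ← hx]
  linarith [hw q hbox]

/-- A polynomial that is larger than the abscissa on the box is feasible of all large orders. -/
theorem exists_forall_isFeasible (p : ParamPoly n) (hp : p.Monic) (hm : 0 < p.natDegree)
    {w : MvPolynomial (Fin n) ℝ} (hw : ∀ q ∈ box n, abscissa p q < MvPolynomial.eval q w) :
    ∃ d₀ : ℕ, ∀ d ≥ d₀, IsFeasible p d w := by
  obtain ⟨σ₀, σ, τRe, τIm, h₀, h, e⟩ := ofQ_sub_varX_mem_constraintModule p hp hm hw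
  -- Large enough for all degree bounds at once, including the truncated differences `2d - 2` and
  -- `2d - m`.
  refine ⟨w.totalDegree + σ₀.totalDegree + ∑ j, (σ j).totalDegree + τRe.totalDegree
    + τIm.totalDegree + p.natDegree + 1, fun d hd => ⟨by omega, σ₀, σ, τRe, τIm, ⟨h₀, by omega⟩,
    fun j => ⟨h j, ?_⟩, by omega, by omega, e⟩⟩
  have hj : (σ j).totalDegree ≤ ∑ j, (σ j).totalDegree :=
    Finset.single_le_sum (f := fun j => (σ j).totalDegree) (fun _ _ => Nat.zero_le _)
      (Finset.mem_univ j)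
  omega

/-- At a root attaining the abscissa, the terms with `p_Re` and `p_Im` vanish and the others are
nonnegative on the box. -/
theorem IsFeasible.abscissa_le {p : ParamPoly n} (hp : p.Monic) (hm : 0 < p.natDegree) {d : ℕ}
    {v : MvPolynomial (Fin n) ℝ} (hv : IsFeasible p d v) {q : Fin n → ℝ} (hq : q ∈ box n) :
    abscissa p q ≤ MvPolynomial.eval q v := by
  obtain ⟨-, σ₀, σ, τRe, τIm, ⟨h₀, -⟩, h, -, -, e⟩ := hv
  obtain ⟨s, hs, hre⟩ := (abscissa_isGreatest p hp hm q).1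
  rw [← Complex.re_add_im s, isRoot_iff] at hs
  have hnonneg : ∀ f : QXY n, IsSumSq f → 0 ≤ evalQXY q s.re s.im f := by
    intro f hf
    induction hf with
    | zero => simp [evalQXY]
    | sq_add a _ ih =>
      simp only [evalQXY, map_add, map_mul] at ih ⊢
      exact add_nonneg (mul_self_nonneg _) ih
  have h' := congrArg (evalQXY q s.re s.im) e
  have hsum : 0 ≤ evalQXY q s.re s.im (∑ j, σ j * (1 - ofQ (MvPolynomial.X j) ^ 2)) := by
    rw [evalQXY, map_sum]
    refine Finset.sum_nonneg fun j _ => ?_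
    rw [map_mul, map_sub, map_pow, map_one]
    refine mul_nonneg (hnonneg _ (h j).1) ?_
    have := evalQXY_ofQ q s.re s.im (MvPolynomial.X j)
    rw [evalQXY, MvPolynomial.eval_X] at this
    rw [this]
    linarith [mem_box_iff.1 hq j]
  have hX : evalQXY q s.re s.im (varX n) = s.re := by simp [evalQXY, varX]
  have hV := evalQXY_ofQ q s.re s.im v
  have h₀' := hnonneg _ h₀
  obtain ⟨hs₁, hs₂⟩ := hs
  simp only [evalQXY] at h' hX hV hs₁ hs₂ hsum h₀'
  rw [map_sub, map_add, map_add, map_add, map_mul _ τRe, map_mul _ τIm, hs₁, hs₂, hX, hV] at h'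
  linarith

end Abscissa

/-! ### Continuity of the abscissa -/

namespace Abscissa

variable {n : ℕ}

theorem continuous_coeff_specialize (p : ParamPoly n) (i : ℕ) :
    Continuous fun q => (specialize p q).coeff i := by
  simp only [specialize, Polynomial.coeff_map, RingHom.comp_apply, Complex.coe_algebraMap]
  exact Complex.continuous_ofReal.comp (MvPolynomial.continuous_eval _)

/-- The roots of `p(q, ·)` are bounded locally uniformly in `q`. -/
theorem eventually_norm_root_le (p : ParamPoly n) (hp : p.Monic) (q₀ : Fin n → ℝ) :
    ∃ R : ℝ, ∀ᶠ q in 𝓝 q₀, ∀ s, (specialize p q).IsRoot s → ‖s‖ ≤ R := by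
  have hc : Continuous fun q => Polynomial.cauchyBound (specialize p q) := by
    have h : ∀ q, Polynomial.cauchyBound (specialize p q)
        = (Finset.range p.natDegree).sup (fun i => ‖(specialize p q).coeff i‖₊) + 1 := by
      intro q
      have hmon : (specialize p q).Monic := hp.map _
      rw [Polynomial.cauchyBound, hmon.leadingCoeff, nnnorm_one, div_one,
        show (specialize p q).natDegree = p.natDegree from hp.natDegree_map _]
    simp only [h]
    exact (Continuous.finset_sup_apply fun i _ =>
      (continuous_coeff_specialize p i).nnnorm).add continuous_const
  refine ⟨(Polynomial.cauchyBound (specialize p q₀) + 1 : NNReal), ?_⟩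
  filter_upwards [hc.continuousAt.eventually_lt continuousAt_const
    (lt_add_one (Polynomial.cauchyBound (specialize p q₀)))] with q hq s hs
  have hmon : (specialize p q).Monic := hp.map _
  exact_mod_cast ((hs.norm_lt_cauchyBound hmon.ne_zero).trans hq).le

/-- The abscissa is a continuous function of the parameter. -/
theorem continuous_abscissa (p : ParamPoly n) (hp : p.Monic) (hm : 0 < p.natDegree) :
    Continuous (abscissa p) := by
  have hmon : ∀ q, (specialize p q).Monic := fun q => hp.map _
  have hdeg : ∀ q, (specialize p q).natDegree = p.natDegree := fun q => hp.natDegree_map _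
  refine continuous_iff_continuousAt.2 fun q₀ => Metric.tendsto_nhds.2 fun ε hε => ?_
  -- The root perturbation bound depends on the norm of the root. A uniform `R` lets one `δ` serve
  -- both from `q₀` to `q` and from `q` to `q₀`.
  obtain ⟨R, hR⟩ := eventually_norm_root_le p hp q₀
  obtain ⟨δ, hδ, hδε⟩ : ∃ δ : ℝ, 0 < δ ∧
      ((p.natDegree + 1) * δ) ^ (p.natDegree : ℝ)⁻¹ * max R 1 < ε := by
    have hcont : ContinuousAt
        (fun δ : ℝ => ((p.natDegree + 1) * δ) ^ (p.natDegree : ℝ)⁻¹ * max R 1) 0 := by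
      refine ContinuousAt.mul (ContinuousAt.rpow_const (by fun_prop) (Or.inr ?_))
        continuousAt_const
      positivity
    have hlt : ∀ᶠ δ : ℝ in 𝓝[>] 0,
        ((p.natDegree + 1) * δ) ^ (p.natDegree : ℝ)⁻¹ * max R 1 < ε := by
      refine nhdsWithin_le_nhds (hcont.eventually_lt continuousAt_const ?_)
      simp [Real.zero_rpow (inv_ne_zero (Nat.cast_ne_zero.2 hm.ne')), hε]
    obtain ⟨δ, h₁, h₂⟩ := (hlt.and self_mem_nhdsWithin).exists
    exact ⟨δ, h₂, h₁⟩
  have hcoeff : ∀ᶠ q in 𝓝 q₀, ∀ i, ‖(specialize p q).coeff i - (specialize p q₀).coeff i‖ < δ := by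
    have h : ∀ᶠ q in 𝓝 q₀, ∀ i ∈ Finset.range (p.natDegree + 1),
        ‖(specialize p q).coeff i - (specialize p q₀).coeff i‖ < δ := by
      refine (Finset.eventually_all _).2 fun i _ => ?_
      simpa [dist_eq_norm] using
        Metric.tendsto_nhds.1 (continuous_coeff_specialize p i).continuousAt δ hδ
    filter_upwards [h] with q hq i
    by_cases hi : i ∈ Finset.range (p.natDegree + 1)
    · exact hq i hi
    · have hi' : p.natDegree < i := by simpa using hi
      rw [Polynomial.coeff_eq_zero_of_natDegree_lt (by rw [hdeg]; exact hi'),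
        Polynomial.coeff_eq_zero_of_natDegree_lt (by rw [hdeg]; exact hi')]
      simpa using hδ
  have key : ∀ q q' : Fin n → ℝ, (∀ s, (specialize p q).IsRoot s → ‖s‖ ≤ R) →
      (∀ i, ‖(specialize p q').coeff i - (specialize p q).coeff i‖ < δ) →
      abscissa p q < abscissa p q' + ε := by
    intro q q' hR hc
    obtain ⟨s, hs, hre⟩ := (abscissa_isGreatest p hp hm q).1
    obtain ⟨b, hb, hsb⟩ := Polynomial.exists_roots_norm_sub_lt_of_norm_coeff_sub_lt hδ hs (hmon q)
      (hmon q') (by rw [hdeg, hdeg]) hc (IsAlgClosed.splits _)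
    have hb' : b.re ≤ abscissa p q' :=
      (abscissa_isGreatest p hp hm q').2 ⟨b, Polynomial.isRoot_of_mem_roots hb, rfl⟩
    have h₁ : s.re - b.re ≤ ‖s - b‖ := by
      rw [← Complex.sub_re]; exact Complex.re_le_norm _
    rw [hdeg] at hsb
    have h₂ : ((p.natDegree + 1) * δ) ^ (p.natDegree : ℝ)⁻¹ * max ‖s‖ 1
        ≤ ((p.natDegree + 1) * δ) ^ (p.natDegree : ℝ)⁻¹ * max R 1 := by
      gcongr
      exact hR s hs
    linarith
  filter_upwards [hR, hcoeff] with q hRq hcq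
  rw [Real.dist_eq, abs_lt]
  constructor
  · linarith [key q₀ q hR.self_of_nhds hcq]
  · linarith [key q q₀ hRq fun i => by rw [norm_sub_rev]; exact hcq i]

/-! ### Polynomial approximation and convergence of the integrals -/

theorem isCompact_box (n : ℕ) : IsCompact (box n) := isCompact_Icc

/-- Continuous functions are approximated by polynomials, uniformly on compact sets. -/
theorem exists_mvPolynomial_near {ι : Type*} {f : (ι → ℝ) → ℝ} (hf : Continuous f)
    {K : Set (ι → ℝ)} (hK : IsCompact K) {ε : ℝ} (hε : 0 < ε) :
    ∃ w : MvPolynomial ι ℝ, ∀ q ∈ K, |MvPolynomial.eval q w - f q| < ε := by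
  let F : MvPolynomial ι ℝ →ₐ[ℝ] C(ι → ℝ, ℝ) :=
    MvPolynomial.aeval fun i => ⟨fun q => q i, continuous_apply i⟩
  have hF : ∀ w q, F w q = MvPolynomial.eval q w := by
    intro w q
    induction w using MvPolynomial.induction_on with
    | C c => simp [F]
    | add f g hf hg => simp [hf, hg]
    | mul_X f i hf => simp [hf, F]
  have hsep : F.range.SeparatesPoints := by
    intro q q' hne
    obtain ⟨i, hi⟩ := Function.ne_iff.1 hne
    exact ⟨F (MvPolynomial.X i), ⟨_, ⟨MvPolynomial.X i, rfl⟩, rfl⟩, by simpa [hF] using hi⟩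
  obtain ⟨_, ⟨w, rfl⟩, hw⟩ :=
    ContinuousMap.exists_mem_subalgebra_near_continuous_of_isCompact_of_separatesPoints hsep
      ⟨f, hf⟩ hK hε
  exact ⟨w, fun q hq => by simpa [hF] using hw q hq⟩

theorem integrable_of_continuous {f : (Fin n → ℝ) → ℝ} (hf : Continuous f) :
    Integrable f (volume.restrict (box n)) :=
  (hf.continuousOn.integrableOn_compact (isCompact_box n))

theorem integrable_abscissa (p : ParamPoly n) (hp : p.Monic) (hm : 0 < p.natDegree) :
    Integrable (abscissa p) (volume.restrict (box n)) :=
  integrable_of_continuous (continuous_abscissa p hp hm)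

theorem integrable_eval (v : MvPolynomial (Fin n) ℝ) :
    Integrable (fun q => MvPolynomial.eval q v) (volume.restrict (box n)) :=
  integrable_of_continuous (MvPolynomial.continuous_eval v)

/-- For every `ε > 0` some polynomial above the abscissa has integral less than
`∫ abscissa + ε`, and it is feasible of all large orders. -/
theorem exists_isFeasible_objective_lt (p : ParamPoly n) (hp : p.Monic) (hm : 0 < p.natDegree)
    {ε : ℝ} (hε : 0 < ε) : ∃ w : MvPolynomial (Fin n) ℝ,
      objective w < (∫ q in box n, abscissa p q) + ε ∧ ∃ d₀ : ℕ, ∀ d ≥ d₀, IsFeasible p d w := by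
  set V : ℝ := volume.real (box n) with hV
  have hV0 : 0 ≤ V := measureReal_nonneg
  -- Approximating `a + η` within `η` gives `a < w < a + 2η`, at a cost in the integral of at most
  -- `2ηV < ε`.
  set η : ℝ := ε / (2 * (V + 1)) with hη
  have hη0 : 0 < η := by positivity
  obtain ⟨w, hw⟩ := exists_mvPolynomial_near
    ((continuous_abscissa p hp hm).add continuous_const) (isCompact_box n) (ε := η) hη0
    (f := fun q => abscissa p q + η)
  refine ⟨w, ?_, exists_forall_isFeasible p hp hm fun q hq => ?_⟩
  · have h : objective w ≤ ∫ q in box n, (abscissa p q + 2 * η) := by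
      refine setIntegral_mono_on (integrable_eval w)
        ((integrable_abscissa p hp hm).add (integrable_of_continuous continuous_const))
        (isCompact_box n).measurableSet fun q hq => ?_
      have := (abs_lt.1 (hw q hq)).2
      linarith
    rw [integral_add (integrable_abscissa p hp hm) (integrable_of_continuous continuous_const),
      setIntegral_const, smul_eq_mul, ← hV] at h
    have h2 : V * (2 * η) < ε := by
      rw [hη, show V * (2 * (ε / (2 * (V + 1)))) = V * ε / (V + 1) by field_simp,
        div_lt_iff₀ (by positivity)]
      nlinarith
    linarith
  · have := (abs_lt.1 (hw q hq)).1
    linarith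

theorem IsFeasible.integral_abscissa_le {p : ParamPoly n} (hp : p.Monic) (hm : 0 < p.natDegree)
    {d : ℕ} {v : MvPolynomial (Fin n) ℝ} (hv : IsFeasible p d v) :
    ∫ q in box n, abscissa p q ≤ objective v :=
  setIntegral_mono_on (integrable_abscissa p hp hm) (integrable_eval v)
    (isCompact_box n).measurableSet fun _ hq => hv.abscissa_le hp hm hq

theorem sdpValue_le {p : ParamPoly n} {d : ℕ} {v : MvPolynomial (Fin n) ℝ}
    (hv : IsFeasible p d v) : sdpValue p d ≤ (objective v : EReal) :=
  iInf₂_le v hv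

theorem le_sdpValue (p : ParamPoly n) (hp : p.Monic) (hm : 0 < p.natDegree) (d : ℕ) :
    ((∫ q in box n, abscissa p q : ℝ) : EReal) ≤ sdpValue p d :=
  le_iInf₂ fun _ hv => EReal.coe_le_coe_iff.2 (hv.integral_abscissa_le hp hm)

/-- A near-optimal solution exists as soon as the program is feasible. -/
theorem IsFeasible.exists_isNearOptimal {p : ParamPoly n} (hp : p.Monic) (hm : 0 < p.natDegree)
    {d : ℕ} (hd : 1 ≤ d) {w : MvPolynomial (Fin n) ℝ} (hw : IsFeasible p d w) :
    ∃ v, IsNearOptimal p d v := by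
  obtain ⟨ρ, hρ⟩ : ∃ ρ : ℝ, sdpValue p d = ρ := by
    -- The value is finite: it is at most `∫ w` and at least `∫ a`.
    refine ⟨(sdpValue p d).toReal, (EReal.coe_toReal ?_ ?_).symm⟩
    · exact ((sdpValue_le hw).trans_lt (EReal.coe_lt_top _)).ne
    · exact ((EReal.bot_lt_coe _).trans_le (le_sdpValue p hp hm d)).ne'
  have hpos : (0 : ℝ) < 1 / d := by positivity
  have hlt : sdpValue p d < ((ρ + 1 / d : ℝ) : EReal) := by
    rw [hρ, EReal.coe_lt_coe_iff]; linarith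
  obtain ⟨v, hv, hvlt⟩ : ∃ v, ∃ _ : IsFeasible p d v,
      (objective v : EReal) < ((ρ + 1 / d : ℝ) : EReal) := by
    simpa only [sdpValue, iInf_lt_iff] using hlt
  refine ⟨v, hv, ?_⟩
  rw [hρ, ← EReal.coe_add]
  exact hvlt.le

/-- The integrals of near-optimal solutions converge to the integral of the abscissa. -/
theorem tendsto_objective (p : ParamPoly n) (hp : p.Monic) (hm : 0 < p.natDegree) {d₀ : ℕ}
    {v : ℕ → MvPolynomial (Fin n) ℝ} (hv : ∀ d ≥ d₀, IsNearOptimal p d (v d)) :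
    Tendsto (fun d => objective (v d)) atTop (𝓝 (∫ q in box n, abscissa p q)) := by
  refine Metric.tendsto_nhds.2 fun ε hε => ?_
  obtain ⟨w, hw, d₁, hd₁⟩ := exists_isFeasible_objective_lt p hp hm (half_pos hε)
  have hsmall : ∀ᶠ d : ℕ in atTop, (1 : ℝ) / d < ε / 2 :=
    tendsto_one_div_atTop_nhds_zero_nat.eventually_lt_const (half_pos hε)
  filter_upwards [hsmall, eventually_ge_atTop d₀, eventually_ge_atTop d₁] with d hd h₀ h₁
  have hlow := (hv d h₀).1.integral_abscissa_le hp hm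
  have hup : objective (v d) ≤ objective w + 1 / d := by
    have h := (hv d h₀).2.trans (add_le_add_left (sdpValue_le (hd₁ d h₁)) _)
    rwa [← EReal.coe_add, EReal.coe_le_coe_iff] at h
  rw [Real.dist_eq, abs_lt]
  constructor <;> linarith

/-- The difference is nonnegative on the box, so its `L¹` norm is its integral. -/
theorem eLpNorm_sub_abscissa {p : ParamPoly n} (hp : p.Monic) (hm : 0 < p.natDegree) {d : ℕ}
    {v : MvPolynomial (Fin n) ℝ} (hv : IsFeasible p d v) :
    eLpNorm (fun q => MvPolynomial.eval q v - abscissa p q) 1 (volume.restrict (box n))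
      = ENNReal.ofReal (objective v - ∫ q in box n, abscissa p q) := by
  have hint : Integrable (fun q => MvPolynomial.eval q v - abscissa p q)
      (volume.restrict (box n)) := (integrable_eval v).sub (integrable_abscissa p hp hm)
  rw [objective, ← integral_sub (integrable_eval v) (integrable_abscissa p hp hm),
    eLpNorm_one_eq_lintegral_enorm, ofReal_integral_eq_lintegral_ofReal hint]
  · refine setLIntegral_congr_fun (isCompact_box n).measurableSet fun q hq => ?_
    exact Real.enorm_of_nonneg (sub_nonneg.2 (hv.abscissa_le hp hm hq))
  · exact (ae_restrict_iff' (isCompact_box n).measurableSet).2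
      (Eventually.of_forall fun q hq => sub_nonneg.2 (hv.abscissa_le hp hm hq))

end Abscissa

theorem mainTheorem1 {n : ℕ} (p : Abscissa.ParamPoly n) (hp : p.Monic) (hm : 0 < p.natDegree) :
    MemLp (Abscissa.abscissa p) 1 (volume.restrict (Abscissa.box n)) ∧
    (∃ d₀ : ℕ, 1 ≤ d₀ ∧ p.natDegree ≤ 2 * d₀ ∧
      ∀ d ≥ d₀, ∃ v : MvPolynomial (Fin n) ℝ, Abscissa.IsNearOptimal p d v) ∧
    ∀ d₀ : ℕ, 1 ≤ d₀ → p.natDegree ≤ 2 * d₀ →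
      ∀ v : ℕ → MvPolynomial (Fin n) ℝ, (∀ d ≥ d₀, Abscissa.IsNearOptimal p d (v d)) →
        (∀ d ≥ d₀, ∀ q ∈ Abscissa.box n, Abscissa.abscissa p q ≤ MvPolynomial.eval q (v d)) ∧
        (∀ d ≥ d₀, MemLp (fun q => MvPolynomial.eval q (v d)) 1
          (volume.restrict (Abscissa.box n))) ∧
        Tendsto (fun d : ℕ => eLpNorm
            (fun q => MvPolynomial.eval q (v d) - Abscissa.abscissa p q) 1
            (volume.restrict (Abscissa.box n)))
          atTop (𝓝 0) := by
  refine ⟨memLp_one_iff_integrable.2 (Abscissa.integrable_abscissa p hp hm), ?_,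
    fun d₀ _ _ v hv => ⟨fun d hd q hq => (hv d hd).1.abscissa_le hp hm hq,
      fun d _ => memLp_one_iff_integrable.2 (Abscissa.integrable_eval (v d)), ?_⟩⟩
  · obtain ⟨w, -, d₁, hd₁⟩ := Abscissa.exists_isFeasible_objective_lt p hp hm one_pos
    exact ⟨d₁ + p.natDegree + 1, by omega, by omega, fun d hd =>
      (hd₁ d (by omega)).exists_isNearOptimal hp hm (by omega)⟩
  · have h := ENNReal.tendsto_ofReal
      ((Abscissa.tendsto_objective p hp hm hv).sub_const
        (∫ q in Abscissa.box n, Abscissa.abscissa p q))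
    rw [sub_self, ENNReal.ofReal_zero] at h
    refine h.congr' ?_
    filter_upwards [eventually_ge_atTop d₀] with d hd
    exact (Abscissa.eLpNorm_sub_abscissa hp hm (hv d hd).1).symm
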